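/- Conventions. Let $M$ be a discrete monoid with unit $1_M$. An $M$-system is a left action of $M$ by continuous maps on a compact metrizable space; two $M$-systems are conjugate, written $\cong$, if there is a homeomorphism between them that commutes with the action of $M$. For a finite alphabet $\Sigma$ let $M$ act on $\Sigma^M$ (with the product topology) by $(mx)_n = x_{nm}$. A subshift over $\Sigma$ is a closed $M$-invariant set $X \subset \Sigma^M$. It is an SFT if there is a clopen set $C \subset \Sigma^M$ such that, for all $x \in \Sigma^M$, $x \in X \iff \forall m \in M: mx \notin C$. It is sofic if it is the image of an SFT, over a possibly different finite alphabet, under a continuous map that commutes with the actions of $M$. For subshifts $Y \subset \Sigma^M$ and $Z \subset (\Sigma^2)^M \cong \Sigma^M \times \Sigma^M$ such that $Z \cap Y^2$ is an equivalence relation on $Y$, let $Y/Z$ be the topological quotient of $Y$ by this relation, with the action $m[y] = [my]$. For classes $S_1$, $S_2$ of subshifts, let $S_1/S_2$ be the class of $M$-systems that are conjugate to $Y/Z$ for some finite alphabet $\Sigma$ and some subshifts $Y \subset \Sigma^M$ in $S_1$ and $Z \subset (\Sigma^2)^M$ in $S_2$ such that $Z \cap Y^2$ is an equivalence relation on $Y$.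 Let $M$-SFT (respectively $M$-sofic) be the class of $M$-systems that are conjugate to an SFT (respectively to a sofic shift) over $M$. Theorem. For every finitely generated infinite monoid $M$, \[ M\text{-SFT} \subsetneq M\text{-sofic} \subsetneq \text{SFT}/\text{SFT} = \text{sofic}/\text{SFT} \subsetneq \text{SFT}/\text{sofic} = \text{sofic}/\text{sofic}, \] where the last four are classes of $M$-systems. -/

import Mathlib

universe u

namespace SymbolicQuotients

/-- The full shift `A ^ M`: all configurations `M → A` over an alphabet `A`. -/
def FullShift (M : Type u) (A : Type) : Type u := M → A

namespace FullShift

variable {M : Type u} {A : Type}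

/-- The product topology of the discrete topologies on the alphabet. -/
instance : TopologicalSpace (FullShift M A) :=
  @Pi.topologicalSpace M (fun _ => A) (fun _ => ⊥)

/-- The left action of `M` by translations, `(m • x) n = x (n * m)`. -/
instance [Monoid M] : MulAction M (FullShift M A) where
  smul m x := fun n => x (n * m)
  one_smul x := funext fun n => congrArg x (mul_one n)
  mul_smul m k x := funext fun n => congrArg x (mul_assoc n m k).symm

/-- The configuration over the pair alphabet with the given two layers. -/
def pair (x y : FullShift M A) : FullShift M (A × A) := fun m => (x m, y m)

theorem smul_pair [Monoid M] (m : M) (x y : FullShift M A) :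
    m • pair x y = pair (m • x) (m • y) := rfl

end FullShift

/-- A subshift over `M` with alphabet `A`: a topologically closed, translation-invariant set of
configurations. -/
structure Subshift (M : Type u) [Monoid M] (A : Type) where
  carrier : Set (FullShift M A)
  isClosed : IsClosed carrier
  smul_mem : ∀ (m : M) (x : FullShift M A), x ∈ carrier → m • x ∈ carrier

namespace Subshift

variable {M : Type u} [Monoid M] {A : Type}

/-- The underlying dynamical system of a subshift. -/
abbrev Points (X : Subshift M A) : Type u := {x : FullShift M A // x ∈ X.carrier}

instance (X : Subshift M A) : MulAction M X.Points where
  smul m x := ⟨m • x.1, X.smul_mem m x.1 x.2⟩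
  one_smul x := Subtype.ext (one_smul M x.1)
  mul_smul m k x := Subtype.ext (mul_smul m k x.1)

/-- Subshifts of finite type: some clopen set `C` of configurations is forbidden at all
positions, and nothing else is. -/
def IsSFT (X : Subshift M A) : Prop :=
  ∃ C : Set (FullShift M A), IsClopen C ∧
    ∀ x : FullShift M A, x ∈ X.carrier ↔ ∀ m : M, m • x ∉ C

/-- Sofic shifts: images of SFTs, possibly over another finite alphabet, under block maps,
that is, under continuous maps that commute with the translations. -/
def IsSofic (Y : Subshift M A) : Prop :=
  ∃ (B : Type) (_ : Finite B) (X : Subshift M B), X.IsSFT ∧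
    ∃ f : X.Points → Y.Points, Continuous f ∧ (∀ (m : M) (x : X.Points), f (m • x) = m • f x) ∧
      Function.Surjective f

/-- The binary relation `Z ∩ Y ^ 2` on `Y` given by a subshift `Z` over the pair alphabet. -/
def Rel (Y : Subshift M A) (Z : Subshift M (A × A)) (y y' : Y.Points) : Prop :=
  FullShift.pair y.1 y'.1 ∈ Z.carrier

/-- The set of points of `Y / Z`, which is defined when `Z ∩ Y ^ 2` is an equivalence relation
on `Y`. -/
def Quot (Y : Subshift M A) (Z : Subshift M (A × A)) (h : Equivalence (Y.Rel Z)) : Type u :=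
  Quotient (Setoid.mk (Y.Rel Z) h)

/-- `Y / Z` carries the quotient topology. -/
instance (Y : Subshift M A) (Z : Subshift M (A × A)) (h : Equivalence (Y.Rel Z)) :
    TopologicalSpace (Y.Quot Z h) :=
  inferInstanceAs (TopologicalSpace (Quotient (Setoid.mk (Y.Rel Z) h)))

/-- The class of a point of `Y` in `Y / Z`. -/
def Quot.mk (Y : Subshift M A) (Z : Subshift M (A × A)) (h : Equivalence (Y.Rel Z))
    (y : Y.Points) : Y.Quot Z h :=
  Quotient.mk (Setoid.mk (Y.Rel Z) h) y

/-- The action of `M` on `Y / Z` is given by `m • [y] = [m • y]`. -/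
instance (Y : Subshift M A) (Z : Subshift M (A × A)) (h : Equivalence (Y.Rel Z)) :
    MulAction M (Y.Quot Z h) where
  smul m := Quotient.map (m • ·) fun y y' hy => Z.smul_mem m (FullShift.pair y.1 y'.1) hy
  one_smul q := Quotient.inductionOn q fun y => congrArg (Quot.mk Y Z h) (one_smul M y)
  mul_smul m k q := Quotient.inductionOn q fun y => congrArg (Quot.mk Y Z h) (mul_smul m k y)

theorem Quot.smul_mk (Y : Subshift M A) (Z : Subshift M (A × A)) (h : Equivalence (Y.Rel Z))
    (m : M) (y : Y.Points) : m • Quot.mk Y Z h y = Quot.mk Y Z h (m • y) := rfl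

end Subshift

/-- A topological dynamical system over the discrete monoid `M`: an action of `M` by continuous
maps on a compact metrizable space. -/
structure DynSys (M : Type u) [Monoid M] : Type (u + 1) where
  carrier : Type u
  [topology : TopologicalSpace carrier]
  [compact : CompactSpace carrier]
  [metrizable : TopologicalSpace.MetrizableSpace carrier]
  [action : MulAction M carrier]
  [continuous_smul : ContinuousConstSMul M carrier]

attribute [instance] DynSys.topology DynSys.compact DynSys.metrizable DynSys.action
  DynSys.continuous_smul

/-- Conjugacy: the existence of an `M`-equivariant homeomorphism. -/
def Conjugate (M : Type u) [Monoid M] (X Y : Type u) [TopologicalSpace X] [TopologicalSpace Y]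
    [MulAction M X] [MulAction M Y] : Prop :=
  ∃ e : X ≃ₜ Y, ∀ (m : M) (x : X), e (m • x) = m • e x

/-- A class of subshifts over `M`. -/
abbrev SubshiftClass (M : Type u) [Monoid M] := ∀ {A : Type}, Subshift M A → Prop

/-- The dynamical systems that are conjugate to a subshift, over some finite alphabet, in the
class `S`. -/
def systemsOf {M : Type u} [Monoid M] (S : SubshiftClass M) : Set (DynSys M) :=
  {X | ∃ (A : Type) (_ : Finite A) (Y : Subshift M A), S Y ∧ Conjugate M Y.Points X.carrier}

/-- The class `S₁ / S₂` of the dynamical systems that are conjugate to `Y / Z` for some subshifts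
`Y` in `S₁` over a finite alphabet `A` and `Z` in `S₂` over `A × A` such that `Y / Z` is
defined. -/
def systemsPer {M : Type u} [Monoid M] (S₁ S₂ : SubshiftClass M) : Set (DynSys M) :=
  {X | ∃ (A : Type) (_ : Finite A) (Y : Subshift M A) (Z : Subshift M (A × A)),
    S₁ Y ∧ S₂ Z ∧ ∃ h : Equivalence (Y.Rel Z), Conjugate M (Y.Quot Z h) X.carrier}

end SymbolicQuotients

namespace SymbolicQuotients

open Set Topology

/-! Both equalities hold because SFTs and sofic shifts are closed under preimages by one-block maps:
a sofic numerator is replaced by an SFT covering it, and the relation is pulled back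
(`systemsPer_isSofic_subset`). A sofic shift is itself a quotient, by the diagonal, which is an SFT.
Strictness needs three witnesses, all of which rest on a geodesic ray in the left Cayley graph
(`exists_geodesic_ray`).

SFT versus sofic: the `reachability` shift excludes active paths from sources to targets. Marking a
separating set of positions shows that it is sofic. A long path along the ray can be cut at a
position that a given finite window misses, so no finite window detects the path. By
`IsSFT.of_conjugate`, no conjugate subshift is an SFT either.

Sofic versus SFT/SFT: letters carry an arrow and a binary digit, and configurations are identified
if their arrows agree and the numbers read along the arrows agree modulo 1. Following an arrow
doubles the number, and doubling is expansive at 0 (`eq_zero_of_norm_lt`), so angles that are close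
at all translates are equal; this makes the relation an SFT. Along the ray, `w0111...` and
`w1000...` are identified, so the quotient is not totally disconnected (`rayConfig_mem_iff`),
whereas every subshift is.

Sofic/SFT versus SFT/sofic: collapse the reachability shift, inside the full shift, to a point. The
relation is sofic (`exists_isSofic_collapse`). Were the quotient in sofic/SFT, compactness would
turn the forbidden pairs into a closed set of forbidden configurations, and the collapsed shift
would be an SFT (`isSFT_of_collapse`). -/

theorem isClopen_preimage_of_isLocallyConstant {X α : Type*} [TopologicalSpace X] {f : X → α}
    (hf : IsLocallyConstant f) (s : Set α) : IsClopen (f ⁻¹' s) :=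
  ⟨⟨hf sᶜ⟩, hf s⟩

/-! ### Configuration spaces and block maps -/

namespace FullShift

variable {M : Type u} {A B : Type}

instance [Finite A] : CompactSpace (FullShift M A) := by
  let : TopologicalSpace A := ⊥
  exact inferInstanceAs (CompactSpace (M → A))

instance : T2Space (FullShift M A) := by
  let : TopologicalSpace A := ⊥
  have : DiscreteTopology A := ⟨rfl⟩
  exact inferInstanceAs (T2Space (M → A))

instance : TotallyDisconnectedSpace (FullShift M A) := by
  let : TopologicalSpace A := ⊥
  have : DiscreteTopology A := ⟨rfl⟩
  exact inferInstanceAs (TotallyDisconnectedSpace (M → A))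

instance [Countable M] [Finite A] : SecondCountableTopology (FullShift M A) := by
  let : TopologicalSpace A := ⊥
  have : DiscreteTopology A := ⟨rfl⟩
  exact inferInstanceAs (SecondCountableTopology (M → A))

theorem isLocallyConstant_apply (m : M) : IsLocallyConstant fun x : FullShift M A => x m := by
  let : TopologicalSpace A := ⊥
  have : DiscreteTopology A := ⟨rfl⟩
  exact (IsLocallyConstant.iff_continuous _).2 (continuous_apply (A := fun _ : M => A) m)

theorem continuous_of_apply {X : Type*} [TopologicalSpace X] {f : X → FullShift M A}
    (hf : ∀ m, IsLocallyConstant fun x => f x m) : Continuous f := by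
  let : TopologicalSpace A := ⊥
  exact continuous_pi fun m => (hf m).continuous

/-- A set of configurations that is determined by finitely many coordinates is clopen. -/
theorem isClopen_of_finset {C : Set (FullShift M A)} (F : Finset M)
    (h : ∀ x y, (∀ m ∈ F, x m = y m) → x ∈ C → y ∈ C) : IsClopen C := by
  have key : IsLocallyConstant fun x => x ∈ C := by
    refine (IsLocallyConstant.iff_eventually_eq _).2 fun x => ?_
    have : ∀ᶠ y in 𝓝 x, ∀ m ∈ F, y m = x m := by
      rw [Filter.eventually_all_finset]
      exact fun m _ => (isLocallyConstant_apply m).eventually_eq x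
    filter_upwards [this] with y hy
    exact propext ⟨h y x hy, h x y fun m hm => (hy m hm).symm⟩
  have := key.isClopen_fiber True
  simpa using this

/-- A clopen set of configurations is determined by finitely many coordinates. -/
theorem exists_finset_of_isClopen [Finite A] {C : Set (FullShift M A)} (hC : IsClopen C) :
    ∃ F : Finset M, ∀ x y, (∀ m ∈ F, x m = y m) → x ∈ C → y ∈ C := by
  classical
  have hn : ∀ x ∈ C, ∃ F : Finset M, ∀ y, (∀ m ∈ F, x m = y m) → y ∈ C := by
    intro x hx
    let : TopologicalSpace A := ⊥
    obtain ⟨I, v, hv, hI⟩ := (isOpen_pi_iff (A := fun _ : M => A)).1 hC.isOpen x hx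
    exact ⟨I, fun y hy => hI fun m hm => hy m hm ▸ (hv m hm).2⟩
  choose! F hF using hn
  have hcyl : ∀ x, IsClopen {y : FullShift M A | ∀ m ∈ F x, x m = y m} := fun x =>
    isClopen_of_finset (F x) fun y z hyz hy m hm => (hy m hm).trans (hyz m hm)
  obtain ⟨T, hTC, hT⟩ := hC.isClosed.isCompact.elim_nhds_subcover
    (fun x => {y : FullShift M A | ∀ m ∈ F x, x m = y m})
    fun x _ => (hcyl x).isOpen.mem_nhds fun m _ => rfl
  refine ⟨T.biUnion F, fun x y hxy hx => ?_⟩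
  obtain ⟨t, ht, hxt⟩ := mem_iUnion₂.1 (hT hx)
  exact hF t (hTC t ht) y fun m hm =>
    (hxt m hm).trans (hxy m (Finset.mem_biUnion.2 ⟨t, ht, hm⟩))

/-- The one-block map given by a map of alphabets. -/
def map (π : A → B) (x : FullShift M A) : FullShift M B := fun m => π (x m)

theorem continuous_map (π : A → B) : Continuous (map π : FullShift M A → FullShift M B) :=
  continuous_of_apply fun m => (isLocallyConstant_apply m).comp π

variable [Monoid M]

theorem smul_apply (m n : M) (x : FullShift M A) : (m • x) n = x (n * m) := rfl

theorem smul_map (π : A → B) (m : M) (x : FullShift M A) : m • map π x = map π (m • x) := rfl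

instance : ContinuousConstSMul M (FullShift M A) :=
  ⟨fun m => continuous_of_apply fun n => isLocallyConstant_apply (n * m)⟩

/-- The block map with local rule `v`. -/
def code (v : FullShift M A → B) (x : FullShift M A) : FullShift M B := fun m => v (m • x)

theorem continuous_code {v : FullShift M A → B} (hv : IsLocallyConstant v) :
    Continuous (code v) :=
  continuous_of_apply fun m => hv.comp_continuous (continuous_const_smul m)

theorem smul_code (v : FullShift M A → B) (m : M) (x : FullShift M A) :
    m • code v x = code v (m • x) := funext fun n => congrArg v (mul_smul n m x)

end FullShift

open FullShift

/-! ### Finite type and local rules -/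

namespace Subshift

variable {M : Type u} [Monoid M] {A B : Type}

instance [Finite A] (X : Subshift M A) : CompactSpace X.Points :=
  isCompact_iff_compactSpace.1 X.isClosed.isCompact

theorem coe_smul (X : Subshift M A) (m : M) (x : X.Points) : (m • x).1 = m • x.1 := rfl

instance (X : Subshift M A) : ContinuousConstSMul M X.Points :=
  ⟨fun m => ((continuous_const_smul m).comp continuous_subtype_val).subtype_mk _⟩

/-- The subshift of finite type with forbidden clopen set `C`. -/
def sft (C : Set (FullShift M A)) (hC : IsClopen C) : Subshift M A where
  carrier := {x | ∀ m : M, m • x ∉ C}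
  isClosed := by
    simp only [Set.ofPred_forall]
    exact isClosed_iInter fun m => (hC.compl.preimage (continuous_const_smul m)).isClosed
  smul_mem m x hx k := by simpa [← mul_smul] using hx (k * m)

theorem isSFT_sft (C : Set (FullShift M A)) (hC : IsClopen C) : (sft C hC).IsSFT :=
  ⟨C, hC, fun _ => Iff.rfl⟩

/-- A subshift is of finite type if every configuration outside of it has a translate in a closed
set disjoint from it. -/
theorem isSFT_of_isClosed [Finite A] (X : Subshift M A) {K : Set (FullShift M A)}
    (hK : IsClosed K) (hdisj : Disjoint K X.carrier)
    (h : ∀ x, (∀ m : M, m • x ∉ K) → x ∈ X.carrier) : X.IsSFT := by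
  -- Zero-dimensionality thickens `K` to a clopen set that still misses `X`, so conditions that are
  -- merely closed may be forbidden.
  obtain ⟨C, hC, hKC, hCX⟩ := exists_clopen_of_closed_subset_open hK X.isClosed.isOpen_compl
    (disjoint_left.1 hdisj)
  exact ⟨C, hC, fun x => ⟨fun hx m hm => hCX hm (X.smul_mem m x hx),
    fun hx => h x fun m hm => hx m (hKC hm)⟩⟩

/-- A locally constant function on a subshift extends to the full shift. -/
theorem exists_extension [Finite A] [Finite B] [Nonempty B] (X : Subshift M A)
    {v : X.Points → B} (hv : IsLocallyConstant v) :
    ∃ w : FullShift M A → B, IsLocallyConstant w ∧ ∀ x : X.Points, w x.1 = v x := by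
  let : TopologicalSpace B := ⊥
  have : DiscreteTopology B := ⟨rfl⟩
  obtain ⟨k, hk, -, hkv⟩ := Profinite.exists_lift_of_finite_of_injective_of_surjective
    (Subtype.val : X.Points → FullShift M A) continuous_subtype_val Subtype.val_injective
    (fun _ : B => ()) (fun _ => ⟨Classical.arbitrary B, rfl⟩) v hv.continuous
    (fun _ => ()) continuous_const rfl
  exact ⟨k, (IsLocallyConstant.iff_continuous _).2 hk, congrFun hkv⟩

/-- A block map between subshifts is given by a local rule on the full shift. -/
theorem exists_code [Finite A] [Finite B] [Nonempty B] {X : Subshift M A} {Y : Subshift M B}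
    {f : X.Points → Y.Points} (hf : Continuous f) (hs : ∀ (m : M) x, f (m • x) = m • f x) :
    ∃ v : FullShift M A → B, IsLocallyConstant v ∧ ∀ x : X.Points, code v x.1 = (f x).1 := by
  obtain ⟨v, hv, hvf⟩ := X.exists_extension (v := fun x => (f x).1 1)
    ((isLocallyConstant_apply 1).comp_continuous (continuous_subtype_val.comp hf))
  refine ⟨v, hv, fun x => funext fun m => ?_⟩
  have := hvf (m • x)
  rw [hs] at this
  simpa [coe_smul, FullShift.smul_apply, code] using this

end Subshift

/-! ### Sofic shifts, conjugacy invariance and preimages -/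

namespace Subshift

variable {M : Type u} [Monoid M] {A B : Type}

/-- The sofic shifts are the images of the subshifts of finite type under one-block maps. -/
theorem isSofic_iff [Finite A] {Y : Subshift M A} :
    Y.IsSofic ↔ ∃ (B : Type) (_ : Finite B) (X : Subshift M B) (π : B → A), X.IsSFT ∧
      ∀ y, y ∈ Y.carrier ↔ ∃ x ∈ X.carrier, FullShift.map π x = y := by
  constructor
  · rintro ⟨B, _, X, ⟨C, hC, hX⟩, f, hf, hs, hsurj⟩
    cases isEmpty_or_nonempty A with
    | inl hA =>
      refine ⟨PEmpty, inferInstance, sft univ isClopen_univ, PEmpty.elim, isSFT_sft _ _,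
        fun y => (hA.false (y 1)).elim⟩
    | inr hA =>
    obtain ⟨v, hv, hvf⟩ := exists_code hf hs
    -- The cover is the graph of the block map: its first layer lies in `X`, and its second layer is
    -- computed from the first by `v`.
    have hbad : IsClopen {w : FullShift M (B × A) |
        FullShift.map Prod.fst w ∈ C ∨ v (FullShift.map Prod.fst w) ≠ (w 1).2} := by
      refine (hC.preimage (continuous_map _)).union ?_
      have := ((hv.comp_continuous (continuous_map (Prod.fst : B × A → B))).prodMk
        ((isLocallyConstant_apply (M := M) 1).comp (Prod.snd : B × A → A)))
      exact isClopen_preimage_of_isLocallyConstant this {p | p.1 ≠ p.2}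
    refine ⟨B × A, inferInstance, sft _ hbad, Prod.snd, isSFT_sft _ _, fun y => ⟨fun hy => ?_, ?_⟩⟩
    · obtain ⟨x, hx⟩ := hsurj ⟨y, hy⟩
      refine ⟨fun m => (x.1 m, y m), fun m => ?_, rfl⟩
      rintro (h | h)
      · exact (hX x.1).1 x.2 m h
      · refine h ?_
        have := congrFun (hvf x) m
        rw [hx] at this
        change v (m • x.1) = y (1 * m)
        rwa [one_mul]
    · rintro ⟨w, hw, rfl⟩
      have hx : FullShift.map Prod.fst w ∈ X.carrier := (hX _).2 fun m hm => hw m (Or.inl hm)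
      have : (f ⟨_, hx⟩).1 = FullShift.map Prod.snd w := by
        rw [← hvf]
        funext m
        have := not_not.1 fun h => hw m (Or.inr h)
        rw [FullShift.smul_apply, one_mul] at this
        exact this
      exact this ▸ (f ⟨_, hx⟩).2
  · rintro ⟨B, hB, X, π, hX, hY⟩
    refine ⟨B, hB, X, hX, fun x => ⟨FullShift.map π x.1, (hY _).2 ⟨x.1, x.2, rfl⟩⟩,
      ((continuous_map π).comp continuous_subtype_val).subtype_mk _, fun _ _ => rfl, fun y => ?_⟩
    obtain ⟨x, hx, hxy⟩ := (hY y.1).1 y.2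
    exact ⟨⟨x, hx⟩, Subtype.ext hxy⟩

theorem IsSFT.isSofic [Finite A] {X : Subshift M A} (h : X.IsSFT) : X.IsSofic :=
  ⟨A, inferInstance, X, h, id, continuous_id, fun _ _ => rfl, Function.surjective_id⟩

/-- Conjugacies preserve subshifts of finite type. -/
theorem IsSFT.of_conjugate [Finite A] [Finite B] {X : Subshift M B} {Y : Subshift M A}
    (hX : X.IsSFT) (h : Conjugate M X.Points Y.Points) : Y.IsSFT := by
  obtain ⟨C, hC, hX⟩ := hX
  obtain ⟨e, he⟩ := h
  obtain hY | ⟨⟨y₀, hy₀⟩⟩ := isEmpty_or_nonempty Y.Points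
  · exact ⟨univ, isClopen_univ, fun x =>
      ⟨fun hx => (hY.false ⟨x, hx⟩).elim, fun hx => (hx 1 trivial).elim⟩⟩
  have : Nonempty A := ⟨y₀ 1⟩
  have : Nonempty B := ⟨(e.symm ⟨y₀, hy₀⟩).1 1⟩
  have he' : ∀ (m : M) y, e.symm (m • y) = m • e.symm y := fun m y => by
    rw [e.symm_apply_eq, he, e.apply_symm_apply]
  obtain ⟨f, hf, hfe⟩ := exists_code e.continuous he
  obtain ⟨g, hg, hge⟩ := exists_code e.symm.continuous he'
  -- The local rules make sense on the whole full shift. Forbidden are the `y` whose recoding by `g`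
  -- violates `X` or is not sent back to `y` by `f`.
  refine ⟨{y | code g y ∈ C ∨ f (code g y) ≠ y 1}, ?_, fun y => ⟨fun hy m => ?_, fun hy => ?_⟩⟩
  · refine (hC.preimage (continuous_code hg)).union ?_
    exact isClopen_preimage_of_isLocallyConstant ((hf.comp_continuous (continuous_code hg)).prodMk
      (isLocallyConstant_apply (M := M) 1)) {p | p.1 ≠ p.2}
  · have h1 : code g (m • y) = (m • e.symm ⟨y, hy⟩).1 := by
      rw [← smul_code, hge ⟨y, hy⟩]; rfl
    rintro (h | h)
    · rw [h1, coe_smul] at h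
      exact (hX _).1 (e.symm ⟨y, hy⟩).2 m h
    · refine h ?_
      have h2 := congrFun (hfe (m • e.symm ⟨y, hy⟩)) 1
      rw [he, e.apply_symm_apply] at h2
      rw [h1]
      simpa [code, coe_smul] using h2
  · have hx : code g y ∈ X.carrier :=
      (hX _).2 fun m hm => hy m (Or.inl (by rwa [smul_code] at hm))
    have : (e ⟨_, hx⟩).1 = y := by
      rw [← hfe]
      funext m
      have h1 := not_not.1 fun h => hy m (Or.inr h)
      rw [← smul_code] at h1
      simpa [code, FullShift.smul_apply] using h1
    exact this ▸ (e ⟨_, hx⟩).2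

/-- The preimage of a subshift under a one-block map. -/
def comap (π : B → A) (X : Subshift M A) : Subshift M B where
  carrier := FullShift.map π ⁻¹' X.carrier
  isClosed := X.isClosed.preimage (continuous_map π)
  smul_mem m _ hx := X.smul_mem m _ hx

theorem IsSFT.comap {X : Subshift M A} (h : X.IsSFT) (π : B → A) : (X.comap π).IsSFT := by
  obtain ⟨C, hC, hX⟩ := h
  exact ⟨FullShift.map π ⁻¹' C, hC.preimage (continuous_map π), fun _ => hX _⟩

/-- The fibre product of the SFT cover with the full shift over `B` is an SFT that covers the
preimage. -/
theorem IsSofic.comap [Finite A] [Finite B] {X : Subshift M A} (h : X.IsSofic) (π : B → A) :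
    (X.comap π).IsSofic := by
  obtain ⟨E, _, W, ρ, ⟨C, hC, hW⟩, hX⟩ := isSofic_iff.1 h
  have hbad : IsClopen {w : FullShift M (E × B) |
      FullShift.map Prod.fst w ∈ C ∨ ρ (w 1).1 ≠ π (w 1).2} :=
    (hC.preimage (continuous_map _)).union
      (isClopen_preimage_of_isLocallyConstant (isLocallyConstant_apply (M := M) 1)
        {p : E × B | ρ p.1 ≠ π p.2})
  refine isSofic_iff.2 ⟨E × B, inferInstance, sft _ hbad, Prod.snd, isSFT_sft _ _,
    fun y => ⟨fun hy => ?_, ?_⟩⟩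
  · obtain ⟨x, hx, hxy⟩ := (hX _).1 hy
    refine ⟨fun m => (x m, y m), fun m => ?_, rfl⟩
    rintro (h | h)
    · exact (hW x).1 hx m h
    · exact h (congrFun hxy _)
  · rintro ⟨w, hw, rfl⟩
    refine (hX _).2 ⟨FullShift.map Prod.fst w, (hW _).2 fun m hm => hw m (Or.inl hm),
      funext fun m => ?_⟩
    have := not_not.1 fun h => hw m (Or.inr h)
    simpa [FullShift.smul_apply, FullShift.map] using this

/-- The diagonal subshift over the pair alphabet. -/
def diagonal (M : Type u) [Monoid M] (A : Type) : Subshift M (A × A) :=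
  sft {w | (w 1).1 ≠ (w 1).2}
    (isClopen_preimage_of_isLocallyConstant (isLocallyConstant_apply (M := M) 1)
      {p : A × A | p.1 ≠ p.2})

theorem pair_mem_diagonal {x y : FullShift M A} :
    FullShift.pair x y ∈ (diagonal M A).carrier ↔ x = y := by
  constructor
  · intro h
    funext m
    have := not_not.1 (h m)
    simpa [FullShift.smul_apply, FullShift.pair] using this
  · rintro rfl m
    exact fun h => h rfl

end Subshift

/-! ### Quotients as factors with prescribed kernel -/

open Subshift

variable {M : Type u} [Monoid M]

/-- A system is in `S₁ / S₂` if it is a factor of a subshift in `S₁` whose kernel is given by a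
subshift in `S₂`. -/
theorem mem_systemsPer_iff {S₁ S₂ : SubshiftClass M} {X : DynSys M} :
    X ∈ systemsPer S₁ S₂ ↔ ∃ (A : Type) (_ : Finite A) (Y : Subshift M A)
      (Z : Subshift M (A × A)), S₁ Y ∧ S₂ Z ∧ ∃ φ : Y.Points → X.carrier, Continuous φ ∧
        (∀ (m : M) y, φ (m • y) = m • φ y) ∧ Function.Surjective φ ∧
        ∀ y y', φ y = φ y' ↔ Y.Rel Z y y' := by
  constructor
  · rintro ⟨A, hA, Y, Z, hY, hZ, h, e, he⟩
    refine ⟨A, hA, Y, Z, hY, hZ, fun y => e (Subshift.Quot.mk Y Z h y),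
      e.continuous.comp continuous_quot_mk, fun m y => he m (Subshift.Quot.mk Y Z h y), ?_,
      fun y y' => ?_⟩
    · exact e.surjective.comp Quotient.mk_surjective
    · rw [e.injective.eq_iff]
      exact Quotient.eq (r := Setoid.mk (Y.Rel Z) h)
  · rintro ⟨A, hA, Y, Z, hY, hZ, φ, hφ, hs, hsurj, hker⟩
    have h : Equivalence (Y.Rel Z) :=
      ⟨fun y => (hker y y).1 rfl, fun hy => (hker _ _).1 ((hker _ _).2 hy).symm,
        fun hy hy' => (hker _ _).1 (((hker _ _).2 hy).trans ((hker _ _).2 hy'))⟩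
    have : CompactSpace (Y.Quot Z h) :=
      inferInstanceAs (CompactSpace (Quotient (Setoid.mk (Y.Rel Z) h)))
    let f : Y.Quot Z h → X.carrier := Quotient.lift φ fun y y' hy => (hker y y').2 hy
    have hf : Continuous f := hφ.quotient_lift _
    have hbij : Function.Bijective f := by
      constructor
      · intro q q'
        induction q using Quotient.inductionOn
        induction q' using Quotient.inductionOn
        exact fun hq => Quotient.sound ((hker _ _).1 hq)
      · exact fun x => (hsurj x).elim fun y hy => ⟨Subshift.Quot.mk Y Z h y, hy⟩
    refine ⟨A, hA, Y, Z, hY, hZ, h,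
      hf.homeoOfEquivCompactToT2 (f := Equiv.ofBijective f hbij), fun m q => ?_⟩
    induction q using Quotient.inductionOn
    exact hs m _

theorem systemsOf_mono {S S' : SubshiftClass M}
    (h : ∀ {A : Type} [Finite A] {X : Subshift M A}, S X → S' X) : systemsOf S ⊆ systemsOf S' :=
  fun _ ⟨A, hA, Y, hY, e⟩ => ⟨A, hA, Y, h hY, e⟩

theorem systemsPer_mono {S₁ S₂ S₁' S₂' : SubshiftClass M}
    (h₁ : ∀ {A : Type} [Finite A] {X : Subshift M A}, S₁ X → S₁' X)
    (h₂ : ∀ {A : Type} [Finite A] {X : Subshift M A}, S₂ X → S₂' X) :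
    systemsPer S₁ S₂ ⊆ systemsPer S₁' S₂' :=
  fun _ ⟨A, hA, Y, Z, hY, hZ, e⟩ => ⟨A, hA, Y, Z, h₁ hY, h₂ hZ, e⟩

/-- If the class `S` is closed under preimages by one-block maps, then sofic shifts can be replaced
by subshifts of finite type in the numerator. -/
theorem systemsPer_isSofic_subset {S : SubshiftClass M}
    (hS : ∀ {A B : Type} [Finite A] [Finite B] {X : Subshift M A} (π : B → A),
      S X → S (X.comap π)) :
    systemsPer (M := M) IsSofic S ⊆ systemsPer (M := M) IsSFT S := by
  intro X hX
  rw [mem_systemsPer_iff] at hX ⊢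
  obtain ⟨A, _, Y, Z, hY, hZ, φ, hφ, hs, hsurj, hker⟩ := hX
  obtain ⟨B, hB, W, π, hW, hWY⟩ := isSofic_iff.1 hY
  let ψ : W.Points → Y.Points := fun w => ⟨FullShift.map π w.1, (hWY _).2 ⟨w.1, w.2, rfl⟩⟩
  have hψ : Continuous ψ := ((continuous_map π).comp continuous_subtype_val).subtype_mk _
  refine ⟨B, hB, W, Z.comap (Prod.map π π), hW, hS _ hZ, φ ∘ ψ, hφ.comp hψ, fun m w => ?_,
    hsurj.comp fun y => ?_, fun w w' => hker _ _⟩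
  · exact hs m (ψ w)
  · obtain ⟨w, hw, hwy⟩ := (hWY y.1).1 y.2
    exact ⟨⟨w, hw⟩, Subtype.ext hwy⟩

theorem systemsOf_isSofic_subset :
    systemsOf (M := M) IsSofic ⊆ systemsPer (M := M) IsSofic IsSFT := by
  rintro X ⟨A, hA, Y, hY, e, he⟩
  rw [mem_systemsPer_iff]
  refine ⟨A, hA, Y, diagonal M A, hY, isSFT_sft _ _, e, e.continuous, he, e.surjective,
    fun y y' => ?_⟩
  rw [e.injective.eq_iff, Subshift.Rel, pair_mem_diagonal, Subtype.ext_iff]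

theorem systemsPer_isSFT_isSFT_eq :
    systemsPer (M := M) IsSFT IsSFT = systemsPer (M := M) IsSofic IsSFT :=
  (systemsPer_mono IsSFT.isSofic id).antisymm
    (systemsPer_isSofic_subset fun π h => IsSFT.comap h π)

theorem systemsPer_isSFT_isSofic_eq :
    systemsPer (M := M) IsSFT IsSofic = systemsPer (M := M) IsSofic IsSofic :=
  (systemsPer_mono IsSFT.isSofic id).antisymm
    (systemsPer_isSofic_subset fun π h => IsSofic.comap h π)

/-! ### Word length and geodesic rays -/

section Generators

variable {M : Type u} [Monoid M]

theorem exists_generators (hM : Monoid.FG M) :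
    ∃ (ι : Type) (_ : Finite ι) (g : ι → M),
      Submonoid.closure (range g) = ⊤ ∧ ∃ j, g j = 1 := by
  obtain ⟨S, hS, hfin⟩ := Monoid.fg_iff.1 hM
  obtain ⟨n, f, hf⟩ := hfin.fin_param
  refine ⟨Option (Fin n), inferInstance, fun j => j.elim 1 f, top_unique ?_, none, rfl⟩
  rw [← hS]
  refine Submonoid.closure_mono ?_
  rw [← hf.2]
  rintro _ ⟨i, rfl⟩
  exact ⟨some i, rfl⟩

variable {ι : Type} {g : ι → M}

theorem generators_induction (hg : Submonoid.closure (range g) = ⊤) {P : M → Prop} (one : P 1)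
    (mul : ∀ j m, P m → P (g j * m)) (m : M) : P m := by
  refine Submonoid.closure_induction_left (s := range g) (motive := fun m _ => P m) one ?_
    (hg ▸ Submonoid.mem_top m)
  rintro _ ⟨j, rfl⟩ y _ hy
  exact mul j y hy

theorem exists_wordLength (hg : Submonoid.closure (range g) = ⊤) :
    ∃ len : M → ℕ, (∀ m, len m = 0 ↔ m = 1) ∧ (∀ j m, len (g j * m) ≤ len m + 1) ∧
      ∀ m n, len m = n + 1 → ∃ j m', m = g j * m' ∧ len m' = n := by
  classical
  -- Despite the name, `ball n` consists of the products of exactly `n` generators; the least such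
  -- `n` is the word length.
  let ball : ℕ → Set M := fun n => Nat.rec (motive := fun _ => Set M) {1} (fun _ s => ⋃ j, (g j * ·) '' s) n
  have hex : ∀ m, ∃ n, m ∈ ball n := generators_induction hg ⟨0, rfl⟩ fun j m ⟨n, hn⟩ =>
    ⟨n + 1, mem_iUnion.2 ⟨j, m, hn, rfl⟩⟩
  have hstep : ∀ j m, Nat.find (hex (g j * m)) ≤ Nat.find (hex m) + 1 := fun j m =>
    Nat.find_min' _ (mem_iUnion.2 ⟨j, m, Nat.find_spec (hex m), rfl⟩)
  refine ⟨fun m => Nat.find (hex m), fun m => Nat.find_eq_zero (hex m), hstep,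
    fun m n hmn => ?_⟩
  · change Nat.find (hex m) = n + 1 at hmn
    have : m ∈ ball (n + 1) := hmn ▸ Nat.find_spec (hex m)
    obtain ⟨j, m', hm', rfl⟩ := mem_iUnion.1 this
    refine ⟨j, m', rfl, ?_⟩
    have h1 : Nat.find (hex m') ≤ n := Nat.find_min' _ hm'
    have h2 := hstep j m'
    change Nat.find (hex m') = n
    omega

/-- The left Cayley graph of an infinite finitely generated monoid has a geodesic ray. -/
theorem exists_geodesic_ray [Infinite M] [Finite ι] (hg : Submonoid.closure (range g) = ⊤) :
    ∃ (len : M → ℕ) (p : ℕ → M), (∀ j m, len (g j * m) ≤ len m + 1) ∧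
      (∀ i, ∃ j, p (i + 1) = g j * p i) ∧ ∀ i, len (p i) = i := by
  obtain ⟨len, hzero, hstep, hpred⟩ := exists_wordLength hg
  have hpar : ∀ m, ∃ m', ∀ n, len m = n + 1 → (∃ j, m = g j * m') ∧ len m' = n := by
    intro m
    rcases hn : len m with _ | n
    · exact ⟨1, fun n h => by omega⟩
    · obtain ⟨j, m', h, h'⟩ := hpred m n hn
      refine ⟨m', fun k hk => ⟨⟨j, h⟩, by omega⟩⟩
  choose parent hparent using hpar
  let desc : M → Set M := fun m => {k | ∃ i, len k = i + len m ∧ parent^[i] k = m}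
  have hl : len 1 = 0 := (hzero 1).2 rfl
  have hone : desc 1 = univ := by
    have key : ∀ n k, len k = n → parent^[n] k = 1 := by
      intro n
      induction n with
      | zero => exact fun k hk => (hzero k).1 hk
      | succ n ih => exact fun k hk => ih _ ((hparent k n hk).2)
    exact eq_univ_of_forall fun k => ⟨len k, by rw [hl, add_zero], key _ k rfl⟩
  have hdesc : ∀ m, desc m ⊆ {m} ∪ ⋃ j ∈ {j | len (g j * m) = len m + 1}, desc (g j * m) := by
    rintro m k ⟨i, hi, hk⟩
    rcases i with _ | i
    · exact Or.inl hk
    · right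
      have hlen : ∀ a ≤ i + 1, len (parent^[a] k) = i + 1 + len m - a := by
        intro a
        induction a with
        | zero => exact fun _ => hi
        | succ a ih =>
          intro ha
          rw [Function.iterate_succ_apply']
          exact (hparent _ (i + 1 + len m - (a + 1)) (by rw [ih (by omega)]; omega)).2
      have h1 := hlen i (by omega)
      obtain ⟨⟨j, hj⟩, -⟩ := hparent (parent^[i] k) (len m) (by omega)
      rw [← Function.iterate_succ_apply' parent, hk] at hj
      refine mem_iUnion₂.2 ⟨j, ?_, i, ?_, hj⟩
      · change len (g j * m) = _
        rw [← hj]; omega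
      · rw [← hj]; omega
  have hnext : ∀ m : {m // (desc m).Infinite}, ∃ m' : {m // (desc m).Infinite},
      (∃ j, m'.1 = g j * m.1) ∧ len m'.1 = len m.1 + 1 := by
    rintro ⟨m, hm⟩
    by_contra hcon
    push Not at hcon
    refine hm (Finite.subset ((finite_singleton m).union
      (Finite.biUnion (toFinite _) fun j hj => ?_)) (hdesc m))
    by_contra hinf
    exact hcon ⟨g j * m, hinf⟩ ⟨j, rfl⟩ hj
  choose next hnext₁ hnext₂ using hnext
  let p : ℕ → {m // (desc m).Infinite} :=
    fun n => next^[n] ⟨1, hone ▸ infinite_univ⟩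
  have hp : ∀ n, p (n + 1) = next (p n) := fun n => Function.iterate_succ_apply' _ _ _
  refine ⟨len, fun n => (p n).1, hstep, fun i => by simpa only [hp] using hnext₁ (p i), fun i => ?_⟩
  induction i with
  | zero => exact hl
  | succ i ih => simp only [hp, hnext₂, ih]

end Generators

/-! ### The reachability shift -/

namespace Subshift

variable {M : Type u} [Monoid M] {A B : Type}

/-- The image of a subshift under a one-block map. -/
def image [Finite B] (π : B → A) (X : Subshift M B) : Subshift M A where
  carrier := FullShift.map π '' X.carrier
  isClosed := (X.isClosed.isCompact.image (continuous_map π)).isClosed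
  smul_mem := by
    rintro m _ ⟨x, hx, rfl⟩
    exact ⟨m • x, X.smul_mem m x hx, rfl⟩

theorem isSofic_image [Finite A] [Finite B] (π : B → A) {X : Subshift M B} (hX : X.IsSFT) :
    (X.image π).IsSofic :=
  isSofic_iff.2 ⟨B, inferInstance, X, π, hX, fun _ => Iff.rfl⟩

section Reachability

variable {ι : Type} [Finite ι]

/-- Letters consist of three bits: whether a position is active, whether it is a source, and whether
it is a target. The additional bit marks a set of positions that contains the sources, is closed
under edges of the left Cayley graph to active positions, and avoids the targets. -/
def markedReachability (g : ι → M) : Subshift M (Bool × Bool × Bool × Bool) :=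
  sft {w | ((w 1).2.2.1 ∧ ¬(w 1).1) ∨ (∃ j, (w 1).1 ∧ (w (g j)).2.1 ∧ ¬(w (g j)).1) ∨
      ((w 1).2.2.2 ∧ (w 1).1)} <| by
    classical
    cases nonempty_fintype ι
    refine isClopen_of_finset (insert 1 (Finset.univ.image g)) fun x y hxy hx => ?_
    have h1 : y 1 = x 1 := (hxy 1 (Finset.mem_insert_self _ _)).symm
    have h2 : ∀ j, y (g j) = x (g j) := fun j =>
      (hxy (g j) (Finset.mem_insert_of_mem (Finset.mem_image_of_mem g (Finset.mem_univ j)))).symm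
    simpa only [mem_ofPred_eq, h1, h2] using hx

/-- The configurations where no path of active positions leads from a source to a target. -/
def reachability (g : ι → M) : Subshift M (Bool × Bool × Bool) :=
  (markedReachability g).image Prod.snd

theorem isSofic_reachability (g : ι → M) : (reachability g).IsSofic :=
  isSofic_image _ (isSFT_sft _ _)

theorem mem_reachability_iff {g : ι → M} {y : FullShift M (Bool × Bool × Bool)} :
    y ∈ (reachability g).carrier ↔ ∃ S : Set M, (∀ m, (y m).2.1 → m ∈ S) ∧
      (∀ j m, m ∈ S → (y (g j * m)).1 → g j * m ∈ S) ∧ ∀ m, (y m).2.2 → m ∉ S := by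
  classical
  constructor
  · rintro ⟨w, hw, rfl⟩
    have hw' : ∀ m, _ := fun m => not_or.1 (hw m)
    refine ⟨{m | (w m).1}, fun m hm => ?_, fun j m hm hj => ?_, fun m hm hm' => ?_⟩
    · have := (hw' m).1
      simp only [FullShift.smul_apply, one_mul, not_and, not_not] at this
      exact this hm
    · have := (not_or.1 (hw' m).2).1
      simp only [FullShift.smul_apply, one_mul, not_exists, not_and, not_not] at this
      exact this j hm hj
    · have := (not_or.1 (hw' m).2).2
      simp only [FullShift.smul_apply, one_mul, not_and] at this
      exact this hm hm'
  · rintro ⟨S, h1, h2, h3⟩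
    let w : FullShift M (Bool × Bool × Bool × Bool) := fun m => (decide (m ∈ S), y m)
    refine ⟨w, fun m => ?_, rfl⟩
    have hm : (m • w) 1 = (decide (m ∈ S), y m) := congrArg w (one_mul m)
    rw [mem_ofPred_eq, hm]
    rintro (⟨h, h'⟩ | ⟨j, h, h', h''⟩ | ⟨h, h'⟩)
    · exact h' (decide_eq_true (h1 m h))
    · exact h'' (decide_eq_true (h2 j m (of_decide_eq_true h) h'))
    · exact h3 m h (of_decide_eq_true h')

theorem nonempty_reachability (g : ι → M) : (reachability g).carrier.Nonempty :=
  ⟨fun _ => (false, false, false), mem_reachability_iff.2 ⟨∅, by simp⟩⟩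

/-- A window of `F.card` positions cannot see all of the `F.card + 1` active positions that complete
a path along a geodesic ray. -/
theorem not_isSFT_reachability [Infinite M] {g : ι → M}
    (hg : Submonoid.closure (range g) = ⊤) : ¬(reachability g).IsSFT := by
  classical
  rintro ⟨C, hC, hY⟩
  obtain ⟨F, hF⟩ := exists_finset_of_isClopen hC
  obtain ⟨len, p, hstep, hp, hlen⟩ := exists_geodesic_ray hg
  have hinj : Function.Injective p := fun a b hab => by rw [← hlen a, ← hlen b, hab]
  let n := F.card + 1
  -- The source is `p 0`, the target is `p n`, and the indices in `I` are active. The source itself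
  -- need not be active.
  let z : Set ℕ → FullShift M (Bool × Bool × Bool) := fun I m =>
    (decide (∃ i ∈ I, m = p i), decide (m = p 0), decide (m = p n))
  have hbad : z (Icc 1 n) ∉ (reachability g).carrier := by
    intro h
    obtain ⟨S, h1, h2, h3⟩ := mem_reachability_iff.1 h
    have key : ∀ i ≤ n, p i ∈ S := by
      intro i
      induction i with
      | zero => exact fun _ => h1 _ (by simp [z])
      | succ i ih =>
        intro hi
        obtain ⟨j, hj⟩ := hp i
        rw [hj]
        refine h2 j _ (ih (by omega)) ?_
        rw [← hj]
        simpa [z] using ⟨i + 1, ⟨by omega, hi⟩, rfl⟩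
    exact h3 (p n) (by simp [z]) (key n le_rfl)
  have hgood : ∀ i ∈ Icc 1 n, z (Icc 1 n \ {i}) ∈ (reachability g).carrier := by
    rintro i ⟨hi, hin⟩
    -- The ray before the gap is closed under active edges: an edge raises the length by at most
    -- one, so it cannot jump over `p i`.
    refine mem_reachability_iff.2 ⟨{m | ∃ a < i, m = p a}, fun m hm => ?_, ?_, fun m hm => ?_⟩
    · exact ⟨0, hi, by simpa [z] using hm⟩
    · rintro j _ ⟨a, ha, rfl⟩ hj
      obtain ⟨b, ⟨-, hb⟩, hbj⟩ := of_decide_eq_true hj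
      refine ⟨b, ?_, hbj⟩
      have := hstep j (p a)
      rw [hbj, hlen, hlen] at this
      have : b ≠ i := hb
      omega
    · have hm : m = p n := of_decide_eq_true hm
      rintro ⟨a, ha, hma⟩
      have := hinj (hma.symm.trans hm)
      omega
  refine hbad ((hY _).2 fun m hm => ?_)
  -- Pigeonhole: the translated window misses some `p i`, so deactivating that position is invisible
  -- there.
  obtain ⟨i, hi, him⟩ : ∃ i ∈ Finset.Icc 1 n, p i ∉ F.image (· * m) := by
    by_contra! hcon
    have h1 : ((Finset.Icc 1 n).image p).card ≤ (F.image (· * m)).card :=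
      Finset.card_le_card (Finset.image_subset_iff.2 hcon)
    rw [Finset.card_image_of_injective _ hinj, Nat.card_Icc] at h1
    have := h1.trans Finset.card_image_le
    omega
  refine (hY _).1 (hgood i (by simpa using hi)) m (hF _ _ (fun f hf => ?_) hm)
  have hne : f * m ≠ p i := fun h => him (Finset.mem_image.2 ⟨f, hf, h⟩)
  refine Prod.ext (decide_eq_decide.2 ⟨?_, ?_⟩) rfl
  · rintro ⟨a, ha, h⟩
    exact ⟨a, ⟨ha, fun hai => hne (hai ▸ h)⟩, h⟩
  · rintro ⟨a, ha, h⟩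
    exact ⟨a, ha.1, h⟩

end Reachability

/-! ### Collapsing a sofic shift to a point -/

section Collapse

/-- The alphabet for the equivalence relation that collapses the one-block image of a subshift to a
point: pairs of letters of the covering subshift, or single letters. -/
def collapseLetter (π : B → A) : (B × B) ⊕ A → A × A :=
  Sum.elim (Prod.map π π) fun a => (a, a)

/-- The relation that collapses a nonempty sofic shift to a point is sofic over a finitely generated
monoid. -/
theorem exists_isSofic_collapse [Finite A] {ι : Type} [Finite ι] {g : ι → M}
    (hg : Submonoid.closure (range g) = ⊤) {Y : Subshift M A} (hY : Y.IsSofic)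
    (hne : Y.carrier.Nonempty) :
    ∃ Z : Subshift M (A × A), Z.IsSofic ∧ ∀ x y, FullShift.pair x y ∈ Z.carrier ↔
      x = y ∨ (x ∈ Y.carrier ∧ y ∈ Y.carrier) := by
  classical
  obtain ⟨B, _, X, π, ⟨C, hC, hX⟩, hY⟩ := isSofic_iff.1 hY
  obtain ⟨b⟩ : Nonempty B := by
    obtain ⟨y, hy⟩ := hne
    obtain ⟨x, -, -⟩ := (hY y).1 hy
    exact ⟨x 1⟩
  -- The value `b` is a dummy: `p₁` and `p₂` matter only where all letters are on the left.
  let p₁ : (B × B) ⊕ A → B := Sum.elim Prod.fst fun _ => b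
  let p₂ : (B × B) ⊕ A → B := Sum.elim Prod.snd fun _ => b
  have hsort : IsClopen {w : FullShift M ((B × B) ⊕ A) |
      ∃ j, (w (g j)).isLeft ≠ (w 1).isLeft} := by
    cases nonempty_fintype ι
    refine isClopen_of_finset (insert 1 (Finset.univ.image g)) fun x y hxy hx => ?_
    have h1 : y 1 = x 1 := (hxy 1 (Finset.mem_insert_self _ _)).symm
    have h2 : ∀ j, y (g j) = x (g j) := fun j =>
      (hxy (g j) (Finset.mem_insert_of_mem (Finset.mem_image_of_mem g (Finset.mem_univ j)))).symm
    simpa only [mem_ofPred_eq, h1, h2] using hx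
  -- Comparing the kind of letter along each generator makes the kind constant on all of `M`. Right
  -- letters then give the diagonal, and left letters give pairs of points of `Y`.
  have hbad : IsClopen ({w : FullShift M ((B × B) ⊕ A) |
      ∃ j, (w (g j)).isLeft ≠ (w 1).isLeft} ∪ ({w | (w 1).isLeft} ∩
        (FullShift.map p₁ ⁻¹' C ∪ FullShift.map p₂ ⁻¹' C))) :=
    hsort.union ((isClopen_preimage_of_isLocallyConstant (isLocallyConstant_apply (M := M) 1)
      {c : (B × B) ⊕ A | c.isLeft}).inter ((hC.preimage (continuous_map _)).union
        (hC.preimage (continuous_map _))))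
  refine ⟨(sft _ hbad).image (collapseLetter π), isSofic_image _ (isSFT_sft _ _),
    fun x y => ⟨?_, ?_⟩⟩
  · rintro ⟨w, hw, hwxy⟩
    have hsort : ∀ m, (w m).isLeft = (w 1).isLeft := generators_induction hg rfl fun j m hm => by
      rw [← hm]
      by_contra h
      refine hw m (Or.inl ⟨j, ?_⟩)
      rwa [FullShift.smul_apply, FullShift.smul_apply, one_mul]
    have hx : ∀ m, x m = (collapseLetter π (w m)).1 := fun m =>
      (congrArg Prod.fst (congrFun hwxy m)).symm
    have hy : ∀ m, y m = (collapseLetter π (w m)).2 := fun m =>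
      (congrArg Prod.snd (congrFun hwxy m)).symm
    rcases h : (w 1).isLeft with _ | _
    · left
      funext m
      rw [hx, hy]
      rcases hm : w m with c | c
      · have := hsort m
        simp [hm, h] at this
      · rfl
    · right
      have hl : ∀ m : M, ((m • w) 1).isLeft := fun m => by
        rw [FullShift.smul_apply, hsort, h]
      constructor
      · refine (hY x).2 ⟨FullShift.map p₁ w, (hX _).2 fun m hm => hw m (Or.inr ⟨hl m, Or.inl hm⟩),
          funext fun m => ?_⟩
        rw [hx]
        rcases hm : w m with c | c
        · simp [FullShift.map, collapseLetter, p₁, hm]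
        · have := hsort m
          simp [hm, h] at this
      · refine (hY y).2 ⟨FullShift.map p₂ w, (hX _).2 fun m hm => hw m (Or.inr ⟨hl m, Or.inr hm⟩),
          funext fun m => ?_⟩
        rw [hy]
        rcases hm : w m with c | c
        · simp [FullShift.map, collapseLetter, p₂, hm]
        · have := hsort m
          simp [hm, h] at this
  · rintro (rfl | ⟨hx, hy⟩)
    · refine ⟨fun m => Sum.inr (x m), fun m => ?_, rfl⟩
      rintro (⟨j, hj⟩ | ⟨h, -⟩)
      · exact hj rfl
      · exact Bool.false_ne_true h
    · obtain ⟨x', hx', rfl⟩ := (hY x).1 hx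
      obtain ⟨y', hy', rfl⟩ := (hY y).1 hy
      refine ⟨fun m => Sum.inl (x' m, y' m), fun m => ?_, rfl⟩
      rintro (⟨j, hj⟩ | ⟨-, h | h⟩)
      · exact hj rfl
      · exact (hX x').1 hx' m h
      · exact (hX y').1 hy' m h

end Collapse

end Subshift

/-- Countability of `M` makes the spaces of configurations second countable, hence metrizable. -/
theorem countable_of_generators {M : Type u} [Monoid M] {ι : Type} [Finite ι] {g : ι → M}
    (hg : Submonoid.closure (range g) = ⊤) : Countable M := by
  have : Function.Surjective fun l : List ι => (l.map g).prod :=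
    generators_induction hg ⟨[], rfl⟩ fun j m ⟨l, hl⟩ => ⟨j :: l, by
      simp only [List.map_cons, List.prod_cons] at hl ⊢
      rw [hl]⟩
  exact this.countable

namespace Subshift

variable {M : Type u} [Monoid M] {A B : Type}

/-- A subshift as a dynamical system. -/
abbrev toDynSys [Countable M] [Finite A] (X : Subshift M A) : DynSys M where
  carrier := X.Points
  metrizable := TopologicalSpace.metrizableSpace_of_t3_secondCountable _

/-- A quotient `Y / Z` whose relation is the kernel of a continuous map to a metrizable space, as a
dynamical system. -/
abbrev quotSys [Finite A] (Y : Subshift M A) (Z : Subshift M (A × A)) (h : Equivalence (Y.Rel Z))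
    {T : Type*} [TopologicalSpace T] [TopologicalSpace.MetrizableSpace T] (ψ : Y.Points → T)
    (hψ : Continuous ψ) (hker : ∀ y y', ψ y = ψ y' ↔ Y.Rel Z y y') : DynSys M where
  carrier := Y.Quot Z h
  compact := inferInstanceAs (CompactSpace (Quotient (Setoid.mk (Y.Rel Z) h)))
  metrizable := by
    have : CompactSpace (Y.Quot Z h) :=
      inferInstanceAs (CompactSpace (Quotient (Setoid.mk (Y.Rel Z) h)))
    let f : Y.Quot Z h → T := Quotient.lift ψ fun y y' hy => (hker y y').2 hy
    have hf : Continuous f := hψ.quotient_lift _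
    have hinj : Function.Injective f := by
      intro q q'
      induction q using Quotient.inductionOn
      induction q' using Quotient.inductionOn
      exact fun hq => Quotient.sound ((hker _ _).1 hq)
    exact (hf.isClosedEmbedding hinj).isEmbedding.metrizableSpace
  continuous_smul := ⟨fun m => (continuous_const_smul m).quotient_map'
    fun y y' hy => Z.smul_mem m (FullShift.pair y.1 y'.1) hy⟩

/-- The full shift as a subshift. -/
def full (M : Type u) [Monoid M] (A : Type) : Subshift M A := sft ∅ isClopen_empty

theorem isSFT_full : (full M A).IsSFT := isSFT_sft _ _

theorem mem_full (x : FullShift M A) : x ∈ (full M A).carrier := fun _ h => h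

end Subshift

/-! ### Strictness from the reachability shift -/

open Subshift

variable {M : Type u} [Monoid M]

theorem quotSys_mem_systemsPer {S₁ S₂ : SubshiftClass M} {A : Type} [Finite A] {Y : Subshift M A}
    {Z : Subshift M (A × A)} (hY : S₁ Y) (hZ : S₂ Z) (h : Equivalence (Y.Rel Z))
    {T : Type*} [TopologicalSpace T] [TopologicalSpace.MetrizableSpace T] (ψ : Y.Points → T)
    (hψ : Continuous ψ) (hker : ∀ y y', ψ y = ψ y' ↔ Y.Rel Z y y') :
    quotSys Y Z h ψ hψ hker ∈ systemsPer S₁ S₂ :=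
  ⟨A, inferInstance, Y, Z, hY, hZ, h, Homeomorph.refl (Y.Quot Z h), fun _ _ => rfl⟩

theorem systemsOf_isSFT_ssubset {ι : Type} [Finite ι] [Infinite M] {g : ι → M}
    (hg : Submonoid.closure (range g) = ⊤) :
    systemsOf (M := M) IsSFT ⊂ systemsOf (M := M) IsSofic := by
  have := countable_of_generators hg
  refine ⟨systemsOf_mono IsSFT.isSofic, fun h => ?_⟩
  obtain ⟨B, _, X, hX, hconj⟩ := h (a := (reachability g).toDynSys)
    ⟨_, inferInstance, reachability g, isSofic_reachability g, Homeomorph.refl _, fun _ _ => rfl⟩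
  exact not_isSFT_reachability hg (hX.of_conjugate hconj)

/-- If the full shift with a subshift collapsed to a point is a quotient of a subshift by a subshift
of finite type, then the collapsed subshift is of finite type. -/
theorem isSFT_of_collapse {A : Type} [Finite A] {X : DynSys M}
    (hX : X ∈ systemsPer (M := M) IsSofic IsSFT) {Y : Subshift M A} (hne : Y.carrier.Nonempty)
    {φ : FullShift M A → X.carrier} (hφ : Continuous φ) (hs : ∀ (m : M) x, φ (m • x) = m • φ x)
    (hker : ∀ x y, φ x = φ y ↔ x = y ∨ (x ∈ Y.carrier ∧ y ∈ Y.carrier)) : Y.IsSFT := by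
  obtain ⟨B, _, W, Z, -, ⟨C, hC, hZ⟩, ψ, hψ, hψs, hsurj, hψker⟩ := mem_systemsPer_iff.1 hX
  obtain ⟨a, ha⟩ := hne
  have hfix : ∀ m : M, m • φ a = φ a := fun m => by
    rw [← hs, hker]
    exact Or.inr ⟨Y.smul_mem m a ha, ha⟩
  -- `D` consists of inequivalent pairs and is compact, so its image in the quotient is closed.
  -- Pairing that image with the fixed point `φ a` yields the closed set of forbidden
  -- configurations.
  let D : Set (W.Points × W.Points) := {p | FullShift.pair p.1.1 p.2.1 ∈ C}
  have hpair : Continuous fun p : W.Points × W.Points => FullShift.pair p.1.1 p.2.1 :=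
    continuous_of_apply fun m =>
      ((isLocallyConstant_apply m).comp_continuous (continuous_subtype_val.comp
        continuous_fst)).prodMk ((isLocallyConstant_apply m).comp_continuous
          (continuous_subtype_val.comp continuous_snd))
  have hD : IsCompact D := (hC.isClosed.preimage hpair).isCompact
  have hK : IsClosed ((fun x => (φ x, φ a)) ⁻¹' (Prod.map ψ ψ '' D)) :=
    (hD.image (hψ.prodMap hψ)).isClosed.preimage (hφ.prodMk continuous_const)
  refine Y.isSFT_of_isClosed hK (disjoint_left.2 ?_) fun x hx => ?_
  · rintro x ⟨⟨w, w'⟩, hw, hww⟩ hxY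
    have h1 : ψ w = ψ w' := by
      rw [show ψ w = φ x from congrArg Prod.fst hww, show ψ w' = φ a from congrArg Prod.snd hww]
      exact (hker _ _).2 (Or.inr ⟨hxY, ha⟩)
    have h2 := (hZ _).1 ((hψker w w').1 h1) 1
    rw [one_smul] at h2
    exact h2 hw
  · obtain ⟨w, hw⟩ := hsurj (φ x)
    obtain ⟨w', hw'⟩ := hsurj (φ a)
    have h1 : ψ w = ψ w' := by
      -- Since `φ a` is fixed, the translates of `(w, w')` lie over the pairs `(φ (m • x), φ a)`,
      -- which are not in the image of `D`.
      refine (hψker w w').2 ((hZ _).2 fun m hm => hx m ⟨(m • w, m • w'), hm, ?_⟩)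
      simp only [Prod.map, hψs, hw, hw', hs, hfix]
    rw [hw, hw', hker] at h1
    rcases h1 with rfl | h1
    · exact ha
    · exact h1.1

/-- The relation collapsing a subshift to a point is the kernel of a continuous map to a space of
configurations. -/
theorem exists_collapse_map {A : Type} [Finite A] (Y : Subshift M A) :
    ∃ ψ : FullShift M A → FullShift (Finset M × M) (Option A), Continuous ψ ∧
      ∀ x y, ψ x = ψ y ↔ x = y ∨ (x ∈ Y.carrier ∧ y ∈ Y.carrier) := by
  classical
  let V : Finset M → Set (FullShift M A) := fun F => {x | ∃ y ∈ Y.carrier, ∀ m ∈ F, x m = y m}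
  have hV : ∀ F, IsClopen (V F) := fun F => isClopen_of_finset F fun x y hxy ⟨z, hz, hxz⟩ =>
    ⟨z, hz, fun m hm => (hxy m hm).symm.trans (hxz m hm)⟩
  have hmem : ∀ x, (∀ F, x ∈ V F) → x ∈ Y.carrier := by
    intro x hx
    by_contra hxY
    obtain ⟨C, hC, hxC, hCY⟩ := compact_exists_isClopen_in_isOpen Y.isClosed.isOpen_compl hxY
    obtain ⟨F, hF⟩ := exists_finset_of_isClopen hC
    obtain ⟨y, hy, hxy⟩ := hx F
    exact hCY (hF x y hxy hxC) hy
  -- The sets `V F` are clopen and intersect in `Y`. Coordinate `(F, m)` reveals `x m` only outside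
  -- `V F`: points of `Y` show nothing, and for any other point some `F` reveals every letter.
  refine ⟨fun x i => if x ∈ V i.1 then none else some (x i.2), continuous_of_apply fun i => ?_,
    fun x y => ⟨fun h => ?_, ?_⟩⟩
  · refine (IsLocallyConstant.iff_eventually_eq _).2 fun x => ?_
    have h1 : ∀ᶠ y in 𝓝 x, y ∈ V i.1 ↔ x ∈ V i.1 := by
      by_cases hx : x ∈ V i.1
      · filter_upwards [(hV i.1).isOpen.mem_nhds hx] with y hy using iff_of_true hy hx
      · filter_upwards [(hV i.1).compl.isOpen.mem_nhds hx] with y hy using iff_of_false hy hx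
    filter_upwards [h1, (isLocallyConstant_apply i.2).eventually_eq x] with y hy hy'
    simp only [hy, hy']
  · have key : ∀ x y : FullShift M A,
        (∀ i : Finset M × M, (if x ∈ V i.1 then none else some (x i.2)) =
          if y ∈ V i.1 then none else some (y i.2)) → x ∉ Y.carrier → x = y := by
      intro x y h hx
      obtain ⟨F, hF⟩ := not_forall.1 fun h => hx (hmem x h)
      funext m
      have := h (F, m)
      simp only [hF, if_false] at this
      split_ifs at this
      exact Option.some_injective _ this
    by_cases hx : x ∈ Y.carrier
    · by_cases hy : y ∈ Y.carrier
      · exact Or.inr ⟨hx, hy⟩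
      · exact Or.inl (key y x (fun i => (congrFun h i).symm) hy).symm
    · exact Or.inl (key x y (fun i => congrFun h i) hx)
  · rintro (rfl | ⟨hx, hy⟩)
    · rfl
    · have h : ∀ x ∈ Y.carrier, ∀ F, x ∈ V F := fun x hx F => ⟨x, hx, fun _ _ => rfl⟩
      funext i
      simp only [h x hx, h y hy, if_true]

theorem systemsPer_isSofic_isSFT_ssubset {ι : Type} [Finite ι] [Infinite M] {g : ι → M}
    (hg : Submonoid.closure (range g) = ⊤) :
    systemsPer (M := M) IsSofic IsSFT ⊂ systemsPer (M := M) IsSFT IsSofic := by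
  have := countable_of_generators hg
  refine ⟨?_, fun h => ?_⟩
  · rw [← systemsPer_isSFT_isSFT_eq]
    exact systemsPer_mono id IsSFT.isSofic
  obtain ⟨Z, hZ, hmem⟩ := exists_isSofic_collapse hg (isSofic_reachability g)
    (nonempty_reachability g)
  obtain ⟨ψ, hψ, hker⟩ := exists_collapse_map (reachability g)
  have hker' : ∀ y y' : (full M (Bool × Bool × Bool)).Points,
      ψ y.1 = ψ y'.1 ↔ (full M _).Rel Z y y' := fun y y' => by rw [hker, ← hmem]; rfl
  have heq : Equivalence ((full M (Bool × Bool × Bool)).Rel Z) :=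
    ⟨fun y => (hker' y y).1 rfl, fun hy => (hker' _ _).1 ((hker' _ _).2 hy).symm,
      fun hy hy' => (hker' _ _).1 (((hker' _ _).2 hy).trans ((hker' _ _).2 hy'))⟩
  have : TopologicalSpace.MetrizableSpace (FullShift (Finset M × M) (Option (Bool × Bool × Bool))) :=
    TopologicalSpace.metrizableSpace_of_t3_secondCountable _
  have hX := h (quotSys_mem_systemsPer (S₁ := IsSFT) (S₂ := IsSofic) isSFT_full hZ heq
    (fun y => ψ y.1) (hψ.comp continuous_subtype_val) hker')
  refine not_isSFT_reachability hg (isSFT_of_collapse hX (nonempty_reachability g)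
    (φ := fun x => Subshift.Quot.mk _ Z heq ⟨x, mem_full x⟩)
    (continuous_quot_mk.comp (continuous_id.subtype_mk _)) (fun _ _ => rfl) fun x y => ?_)
  rw [← hmem]
  exact Quotient.eq (r := Setoid.mk _ heq)

/-! ### Expansiveness of doubling on the circle -/

theorem norm_two_nsmul {x : UnitAddCircle} (hx : ‖x‖ < 1 / 4) : ‖2 • x‖ = 2 * ‖x‖ := by
  induction x using QuotientAddGroup.induction_on with | H t =>
  let s : ℝ := t - round t
  have hs : (t : UnitAddCircle) = (s : UnitAddCircle) := by
    have h2 : ((round t : ℝ) : UnitAddCircle) = 0 :=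
      (AddCircle.coe_eq_zero_iff (1 : ℝ)).2 ⟨round t, by simp⟩
    rw [AddCircle.coe_sub, h2, sub_zero]
  have hn : ‖(t : UnitAddCircle)‖ = |s| := UnitAddCircle.norm_eq
  -- The bound `1 / 4` keeps `2 * s` within `1 / 2` of zero, so the norm is not reduced by wrapping
  -- around.
  have h2 : ‖((2 * s : ℝ) : UnitAddCircle)‖ = |2 * s| := by
    rw [AddCircle.norm_coe_eq_abs_iff _ one_ne_zero, abs_mul, abs_two, abs_one]
    change ‖(t : UnitAddCircle)‖ < 1 / 4 at hx
    linarith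
  change ‖2 • (t : UnitAddCircle)‖ = 2 * ‖(t : UnitAddCircle)‖
  rw [hn, hs, ← AddCircle.coe_nsmul, nsmul_eq_mul, Nat.cast_ofNat, h2, abs_mul, abs_two]

/-- Doubling of the circle is positively expansive at `0`. -/
theorem eq_zero_of_norm_lt {α : Type*} {G : Set α} {D : α → UnitAddCircle}
    (hD : ∀ a ∈ G, ‖D a‖ < 1 / 4) (hG : ∀ a ∈ G, ∃ b ∈ G, D b = 2 • D a) {a : α} (ha : a ∈ G) :
    D a = 0 := by
  have key : ∀ n : ℕ, ∀ a ∈ G, ‖D a‖ ≤ (1 / 2) ^ n := by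
    intro n
    induction n with
    | zero => exact fun a ha => by have := hD a ha; rw [pow_zero]; linarith
    | succ n ih =>
      intro a ha
      obtain ⟨b, hb, hab⟩ := hG a ha
      have h1 := ih b hb
      rw [hab, norm_two_nsmul (hD a ha)] at h1
      rw [pow_succ]
      linarith
  have := ge_of_tendsto' (tendsto_pow_atTop_nhds_zero_of_lt_one (r := (1 / 2 : ℝ)) (by norm_num)
    (by norm_num)) fun n => key n a ha
  exact norm_le_zero_iff.1 this

/-! ### Binary expansions along arrows -/

noncomputable section BinaryExpansions

section RayConfig

variable {M : Type u} {ι : Type} {p : ℕ → M} {a : ℕ → ι} {j₀ : ι}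

open Classical in
/-- The configuration with arrows `a` and digits `d` along the ray `p`. -/
def rayConfig (p : ℕ → M) (a : ℕ → ι) (j₀ : ι) (d : ℕ → Bool) : FullShift M (ι × Bool) := fun m =>
  if h : ∃ i, m = p i then (a h.choose, d h.choose) else (j₀, false)

theorem rayConfig_apply (hp : Function.Injective p) (d : ℕ → Bool) (i : ℕ) :
    rayConfig p a j₀ d (p i) = (a i, d i) := by
  have h : ∃ k, p i = p k := ⟨i, rfl⟩
  have h1 : h.choose = i := (hp h.choose_spec).symm
  rw [rayConfig, dif_pos h, h1]

theorem rayConfig_of_notMem {d : ℕ → Bool} {m : M} (h : ¬∃ i, m = p i) :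
    rayConfig p a j₀ d m = (j₀, false) := dif_neg h

theorem fst_rayConfig (d d' : ℕ → Bool) (m : M) :
    (rayConfig p a j₀ d m).1 = (rayConfig p a j₀ d' m).1 := by
  unfold rayConfig
  split_ifs <;> rfl

end RayConfig

variable {M : Type u} [Monoid M] {ι : Type} (g : ι → M)

/-- Letters consist of an arrow along an edge of the left Cayley graph and a binary digit. This map
follows the arrow at the origin. -/
def step (y : FullShift M (ι × Bool)) : FullShift M (ι × Bool) := g (y 1).1 • y

/-- The digit at the origin. -/
def digit (y : FullShift M (ι × Bool)) : ℝ := if (y 1).2 then 1 else 0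

/-- The number whose binary digits are read along the arrows from the origin. -/
def binary (y : FullShift M (ι × Bool)) : ℝ :=
  ∑' i : ℕ, digit ((step g)^[i] y) * (1 / 2) ^ (i + 1)

/-- The residue of `binary g y` modulo `1`. -/
def angle (y : FullShift M (ι × Bool)) : UnitAddCircle := (binary g y : UnitAddCircle)

/-- The arrow at the origin is locally constant, so locally this is translation by a fixed element.
-/
theorem continuous_step : Continuous (step g) := by
  refine continuous_iff_continuousAt.2 fun y => ?_
  refine ((continuous_const_smul (g (y 1).1)).continuousAt (x := y)).congr ?_
  filter_upwards [(isLocallyConstant_apply (M := M) 1).eventually_eq y] with z hz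
  simp only [step, hz]

theorem continuous_digit : Continuous (digit : FullShift M (ι × Bool) → ℝ) :=
  ((isLocallyConstant_apply (M := M) 1).comp
    fun p : ι × Bool => (if p.2 then 1 else 0 : ℝ)).continuous

theorem norm_digit_mul_le (y : FullShift M (ι × Bool)) (i : ℕ) :
    ‖digit y * (1 / 2) ^ (i + 1)‖ ≤ (1 / 2) ^ (i + 1) := by
  rw [norm_mul, norm_pow, Real.norm_of_nonneg (by norm_num : (0 : ℝ) ≤ 1 / 2)]
  refine mul_le_of_le_one_left (by positivity) ?_
  unfold digit
  split_ifs <;> simp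

theorem summable_half_pow : Summable fun i : ℕ => (1 / 2 : ℝ) ^ (i + 1) :=
  (summable_nat_add_iff 1).2 summable_geometric_two

theorem continuous_binary : Continuous (binary (M := M) g) :=
  continuous_tsum (fun i => (continuous_digit.comp ((continuous_step g).iterate i)).mul
    continuous_const) summable_half_pow fun i _ => norm_digit_mul_le _ i

theorem continuous_angle : Continuous (angle (M := M) g) :=
  (AddCircle.continuous_mk' 1).comp (continuous_binary g)

theorem two_mul_binary (y : FullShift M (ι × Bool)) :
    2 * binary g y = digit y + binary g (step g y) := by
  have hs : Summable fun i : ℕ => digit ((step g)^[i] y) * (1 / 2) ^ (i + 1) :=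
    Summable.of_norm_bounded summable_half_pow fun i => norm_digit_mul_le _ i
  have h1 : ∀ i : ℕ, digit ((step g)^[i + 1] y) * (1 / 2) ^ (i + 1 + 1) =
      1 / 2 * (digit ((step g)^[i] (step g y)) * (1 / 2) ^ (i + 1)) := fun i => by
    rw [Function.iterate_succ_apply]; ring
  rw [binary, hs.tsum_eq_zero_add]
  simp only [h1, tsum_mul_left, Function.iterate_zero_apply]
  rw [← binary]
  ring

/-- The discarded leading digit is an integer and vanishes modulo `1`. -/
theorem angle_step (y : FullShift M (ι × Bool)) : angle g (step g y) = 2 • angle g y := by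
  have h : binary g (step g y) = 2 * binary g y - digit y := by linarith [two_mul_binary g y]
  have hd : ((digit y : ℝ) : UnitAddCircle) = 0 := by
    unfold digit
    split_ifs
    · exact AddCircle.coe_period 1
    · exact AddCircle.coe_zero 1
  rw [angle, h, AddCircle.coe_sub, hd, sub_zero, angle, ← AddCircle.coe_nsmul, nsmul_eq_mul,
    Nat.cast_ofNat]

/-- The relation that two configurations have the same arrows, and the same binary expansions modulo
`1` along them. -/
def angleRel : Subshift M ((ι × Bool) × (ι × Bool)) where
  carrier := {w | ∀ m : M, (w m).1.1 = (w m).2.1 ∧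
    angle g (m • map Prod.fst w) = angle g (m • map Prod.snd w)}
  isClosed := by
    simp only [Set.ofPred_forall, Set.ofPred_and]
    refine isClosed_iInter fun m => IsClosed.inter ?_ (isClosed_eq ?_ ?_)
    · exact (isClopen_preimage_of_isLocallyConstant (isLocallyConstant_apply m)
        {p : (ι × Bool) × (ι × Bool) | p.1.1 = p.2.1}).isClosed
    · exact (continuous_angle g).comp ((continuous_const_smul m).comp (continuous_map _))
    · exact (continuous_angle g).comp ((continuous_const_smul m).comp (continuous_map _))
  smul_mem m w hw k := by
    refine ⟨(hw (k * m)).1, ?_⟩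
    rw [← smul_map, ← smul_map, ← mul_smul, ← mul_smul]
    exact (hw (k * m)).2

/-- It suffices to forbid different arrows and angles at distance at least `1 / 4`. If no translate
is forbidden, the difference of the angles doubles along the common arrows and stays small, so it is
zero. -/
theorem isSFT_angleRel [Finite ι] : (angleRel (M := M) g).IsSFT := by
  let D : FullShift M ((ι × Bool) × (ι × Bool)) → UnitAddCircle := fun w =>
    angle g (map Prod.fst w) - angle g (map Prod.snd w)
  have hDc : Continuous D := ((continuous_angle g).comp (continuous_map _)).sub
    ((continuous_angle g).comp (continuous_map _))
  have hK : IsClosed {w : FullShift M ((ι × Bool) × (ι × Bool)) |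
      (w 1).1.1 ≠ (w 1).2.1 ∨ 1 / 4 ≤ ‖D w‖} := by
    refine IsClosed.union ?_ (isClosed_le continuous_const hDc.norm)
    exact (isClopen_preimage_of_isLocallyConstant (isLocallyConstant_apply (M := M) 1)
      {p : (ι × Bool) × (ι × Bool) | p.1.1 ≠ p.2.1}).isClosed
  refine (angleRel g).isSFT_of_isClosed hK (disjoint_left.2 ?_) fun w hw => ?_
  · rintro w (h | h) hw
    · exact h (hw 1).1
    · have h1 := (hw 1).2
      rw [one_smul, one_smul] at h1
      have h2 : D w = 0 := sub_eq_zero.2 h1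
      rw [h2, norm_zero] at h
      norm_num at h
  · have hG : ∀ w' ∈ {w' | ∃ m : M, w' = m • w}, D w' = 0 := by
      intro w' hw'
      refine eq_zero_of_norm_lt ?_ ?_ hw'
      · rintro _ ⟨m, rfl⟩
        exact not_le.1 (not_or.1 (hw m)).2
      · rintro _ ⟨m, rfl⟩
        -- Equal arrows let a single translation perform `step` in both layers.
        have harrow := not_not.1 (not_or.1 (hw m)).1
        refine ⟨g ((m • w) 1).1.1 • m • w, ⟨_, (mul_smul _ m w).symm⟩, ?_⟩
        have h1 : map Prod.fst (g ((m • w) 1).1.1 • m • w) = step g (map Prod.fst (m • w)) := rfl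
        have h2 : map Prod.snd (g ((m • w) 1).1.1 • m • w) = step g (map Prod.snd (m • w)) := by
          rw [harrow]; rfl
        simp only [D, h1, h2, angle_step, nsmul_sub]
    intro m
    have h1 := not_not.1 (not_or.1 (hw m)).1
    rw [FullShift.smul_apply, one_mul] at h1
    exact ⟨h1, sub_eq_zero.1 (hG _ ⟨m, rfl⟩)⟩

theorem pair_mem_angleRel {x y : FullShift M (ι × Bool)} :
    FullShift.pair x y ∈ (angleRel g).carrier ↔
      ∀ m : M, (x m).1 = (y m).1 ∧ angle g (m • x) = angle g (m • y) := Iff.rfl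

theorem equivalence_angleRel : Equivalence ((full M (ι × Bool)).Rel (angleRel g)) :=
  ⟨fun _ _ => ⟨rfl, rfl⟩, fun h m => ⟨(h m).1.symm, (h m).2.symm⟩,
    fun h h' m => ⟨(h m).1.trans (h' m).1, (h m).2.trans (h' m).2⟩⟩

section Ray

variable {g} {p : ℕ → M} {a : ℕ → ι} {j₀ : ι}

theorem iterate_step_rayConfig (hp : Function.Injective p) (ha : ∀ i, p (i + 1) = g (a i) * p i)
    (d : ℕ → Bool) (k i : ℕ) :
    (step g)^[k] (p i • rayConfig p a j₀ d) = p (i + k) • rayConfig p a j₀ d := by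
  induction k with
  | zero => rfl
  | succ k ih =>
    rw [Function.iterate_succ_apply', ih, step, FullShift.smul_apply, one_mul, rayConfig_apply hp,
      ← mul_smul, ← ha, add_assoc]

theorem binary_rayConfig (hp : Function.Injective p) (ha : ∀ i, p (i + 1) = g (a i) * p i)
    (d : ℕ → Bool) (i : ℕ) :
    binary g (p i • rayConfig p a j₀ d) =
      ∑' k : ℕ, (if d (i + k) then 1 else 0 : ℝ) * (1 / 2) ^ (k + 1) := by
  refine tsum_congr fun k => ?_
  rw [iterate_step_rayConfig hp ha, digit, FullShift.smul_apply, one_mul, rayConfig_apply hp]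

theorem binary_rayConfig_succ (hp : Function.Injective p)
    (ha : ∀ i, p (i + 1) = g (a i) * p i) (d : ℕ → Bool) (i : ℕ) :
    2 * binary g (p i • rayConfig p a j₀ d) =
      (if d i then 1 else 0) + binary g (p (i + 1) • rayConfig p a j₀ d) := by
  rw [two_mul_binary, digit, FullShift.smul_apply, one_mul, rayConfig_apply hp]
  congr 2
  exact iterate_step_rayConfig hp ha d 1 i

theorem binary_rayConfig_of_false (hp : Function.Injective p)
    (ha : ∀ i, p (i + 1) = g (a i) * p i) {d : ℕ → Bool} {i : ℕ} (hd : ∀ k ≥ i, d k = false) :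
    binary g (p i • rayConfig p a j₀ d) = 0 := by
  rw [binary_rayConfig hp ha]
  simp [hd]

theorem binary_rayConfig_of_true (hp : Function.Injective p)
    (ha : ∀ i, p (i + 1) = g (a i) * p i) {d : ℕ → Bool} {i : ℕ} (hd : ∀ k ≥ i, d k = true) :
    binary g (p i • rayConfig p a j₀ d) = 1 := by
  rw [binary_rayConfig hp ha]
  have : ∀ k : ℕ, (1 / 2 : ℝ) ^ (k + 1) = 1 / 2 * (1 / 2) ^ k := fun k => by ring
  simp only [hd _ (Nat.le_add_right _ _), if_true, one_mul, this, tsum_mul_left,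
    tsum_geometric_two]
  norm_num

/-- Off the ray the arrow is a loop with digit zero, so the value `b` satisfies `2 * b = b`. -/
theorem binary_rayConfig_of_notMem (hj : g j₀ = 1) (d : ℕ → Bool) {m : M} (hm : ¬∃ i, m = p i) :
    binary g (m • rayConfig p a j₀ d) = 0 := by
  have h1 : (m • rayConfig p a j₀ d) 1 = (j₀, false) := by
    rw [FullShift.smul_apply, one_mul, rayConfig_of_notMem hm]
  have h2 := two_mul_binary g (m • rayConfig p a j₀ d)
  rw [step, digit, h1, hj, one_smul] at h2
  simp only [Bool.false_eq_true, if_false] at h2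
  linarith

/-- The expansions `w 0 1 1 1 ⋯` and `w 1 0 0 0 ⋯` are identified. -/
theorem rayConfig_rel (hp : Function.Injective p) (ha : ∀ i, p (i + 1) = g (a i) * p i)
    (hj : g j₀ = 1) {d d' : ℕ → Bool} {n : ℕ} (hlt : ∀ i < n, d i = d' i) (hd : d n = false)
    (hd' : d' n = true) (hgt : ∀ i > n, d i = true) (hgt' : ∀ i > n, d' i = false) :
    FullShift.pair (rayConfig p a j₀ d) (rayConfig p a j₀ d') ∈ (angleRel g).carrier := by
  refine (pair_mem_angleRel g).2 fun m => ⟨fst_rayConfig d d' m, ?_⟩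
  by_cases hm : ∃ i, m = p i
  · obtain ⟨i, rfl⟩ := hm
    rcases lt_or_ge n i with hi | hi
    -- After index `n` the expansions are `111...` and `000...`, with values `1` and `0`: equal only
    -- modulo `1`.
    · rw [angle, angle, binary_rayConfig_of_true hp ha fun k hk => hgt k (hi.trans_le hk),
        binary_rayConfig_of_false hp ha fun k hk => hgt' k (hi.trans_le hk), AddCircle.coe_period,
        AddCircle.coe_zero]
    -- Up to index `n` the real values agree: both are `1 / 2` at `n`, and equality propagates
    -- backwards through the common digits.
    · have key : ∀ k ≤ n, binary g (p (n - k) • rayConfig p a j₀ d) =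
          binary g (p (n - k) • rayConfig p a j₀ d') := by
        intro k
        induction k with
        | zero =>
          intro _
          have h1 := binary_rayConfig_succ (j₀ := j₀) hp ha d n
          have h2 := binary_rayConfig_succ (j₀ := j₀) hp ha d' n
          rw [binary_rayConfig_of_true hp ha fun k hk => hgt k hk, hd] at h1
          rw [binary_rayConfig_of_false hp ha fun k hk => hgt' k hk, hd'] at h2
          simp only [Bool.false_eq_true, if_false, if_true] at h1 h2
          rw [Nat.sub_zero]
          linarith
        | succ k ih =>
          intro hk
          have h1 := binary_rayConfig_succ (j₀ := j₀) hp ha d (n - (k + 1))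
          have h2 := binary_rayConfig_succ (j₀ := j₀) hp ha d' (n - (k + 1))
          have h3 : n - (k + 1) + 1 = n - k := by omega
          rw [h3, ih (by omega), hlt _ (by omega)] at h1
          rw [h3] at h2
          linarith
      have := key (n - i) (by omega)
      rw [Nat.sub_sub_self hi] at this
      rw [angle, angle, this]
  · rw [angle, angle, binary_rayConfig_of_notMem hj d hm, binary_rayConfig_of_notMem hj d' hm]

/-- No clopen set that is invariant under the relation separates configurations on a ray. -/
theorem rayConfig_mem_iff [Finite ι] (hp : Function.Injective p)
    (ha : ∀ i, p (i + 1) = g (a i) * p i) (hj : g j₀ = 1) {V : Set (FullShift M (ι × Bool))}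
    (hV : IsClopen V)
    (hinv : ∀ x y, FullShift.pair x y ∈ (angleRel g).carrier → (x ∈ V ↔ y ∈ V)) (d d' : ℕ → Bool) :
    rayConfig p a j₀ d ∈ V ↔ rayConfig p a j₀ d' ∈ V := by
  -- If membership in `V` depends only on the first `n + 1` digits, it depends only on the first
  -- `n`: extending by `0111...` and by `1000...` gives related configurations. Descent reaches `n =
  -- 0`.
  have key : ∀ n : ℕ, (∀ d d' : ℕ → Bool, (∀ i < n, d i = d' i) →
      (rayConfig p a j₀ d ∈ V ↔ rayConfig p a j₀ d' ∈ V)) →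
      (rayConfig p a j₀ d ∈ V ↔ rayConfig p a j₀ d' ∈ V) := by
    intro n
    induction n with
    | zero => exact fun h => h d d' (by simp)
    | succ n ih =>
      intro h
      have main : ∀ d d' : ℕ → Bool, (∀ i < n, d i = d' i) → d n = false → d' n = true →
          (rayConfig p a j₀ d ∈ V ↔ rayConfig p a j₀ d' ∈ V) := by
        intro d d' hlt hd hd'
        let e : ℕ → Bool := fun i => if i ≤ n then d i else true
        let e' : ℕ → Bool := fun i => if i ≤ n then d' i else false
        have he : ∀ i ≤ n, e i = d i := fun i hi => if_pos hi
        have he' : ∀ i ≤ n, e' i = d' i := fun i hi => if_pos hi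
        rw [h d e fun i hi => (he i (by omega)).symm, h d' e' fun i hi => (he' i (by omega)).symm]
        refine hinv _ _ (rayConfig_rel hp ha hj (n := n) (fun i hi => ?_) ?_ ?_ ?_ ?_)
        · rw [he i hi.le, he' i hi.le, hlt i hi]
        · rw [he n le_rfl, hd]
        · rw [he' n le_rfl, hd']
        · exact fun i hi => if_neg (not_le.2 hi)
        · exact fun i hi => if_neg (not_le.2 hi)
      refine ih fun d d' hlt => ?_
      rcases hd : d n with _ | _ <;> rcases hd' : d' n with _ | _
      · exact h d d' fun i hi => (Nat.lt_succ_iff_lt_or_eq.1 hi).elim (hlt i) fun hi => by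
          rw [hi, hd, hd']
      · exact main d d' hlt hd hd'
      · exact (main d' d (fun i hi => (hlt i hi).symm) hd' hd).symm
      · exact h d d' fun i hi => (Nat.lt_succ_iff_lt_or_eq.1 hi).elim (hlt i) fun hi => by
          rw [hi, hd, hd']
  obtain ⟨F, hF⟩ := exists_finset_of_isClopen hV
  -- The window meets the ray only at indices up to `n`, so the first `n + 1` digits decide
  -- membership.
  obtain ⟨n, hn⟩ := (F.finite_toSet.preimage hp.injOn).bddAbove
  refine key (n + 1) fun d d' h => ?_
  have hagree : ∀ m ∈ F, rayConfig p a j₀ d m = rayConfig p a j₀ d' m := by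
    intro m hm
    by_cases hi : ∃ i, m = p i
    · obtain ⟨i, rfl⟩ := hi
      rw [rayConfig_apply hp, rayConfig_apply hp, h i (Nat.lt_succ_of_le (hn hm))]
    · rw [rayConfig_of_notMem hi, rayConfig_of_notMem hi]
  exact ⟨hF _ _ hagree, hF _ _ fun m hm => (hagree m hm).symm⟩

end Ray

theorem systemsOf_isSofic_ssubset {g : ι → M} [Finite ι] [Infinite M]
    (hg : Submonoid.closure (range g) = ⊤) {j₀ : ι} (hj : g j₀ = 1) :
    systemsOf (M := M) IsSofic ⊂ systemsPer (M := M) IsSFT IsSFT := by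
  have := countable_of_generators hg
  refine ⟨systemsPer_isSFT_isSFT_eq (M := M) ▸ systemsOf_isSofic_subset, fun hsub => ?_⟩
  let _ : TopologicalSpace ι := ⊥
  have : DiscreteTopology ι := ⟨rfl⟩
  let ψ : (full M (ι × Bool)).Points → (M → ι) × (M → UnitAddCircle) := fun y =>
    (fun m => (y.1 m).1, fun m => angle g (m • y.1))
  have hψ : Continuous ψ := by
    refine (continuous_pi fun m => ?_).prodMk (continuous_pi fun m => ?_)
    · exact ((isLocallyConstant_apply m).comp Prod.fst).continuous.comp continuous_subtype_val
    · exact ((continuous_angle g).comp (continuous_const_smul m)).comp continuous_subtype_val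
  have hker : ∀ y y', ψ y = ψ y' ↔ (full M (ι × Bool)).Rel (angleRel g) y y' := fun y y' => by
    rw [Prod.ext_iff, funext_iff, funext_iff, ← forall_and]
    rfl
  have : TopologicalSpace.MetrizableSpace ((M → ι) × (M → UnitAddCircle)) :=
    TopologicalSpace.metrizableSpace_of_t3_secondCountable _
  obtain ⟨B, _, W, -, e, -⟩ := hsub (quotSys_mem_systemsPer (S₁ := IsSFT) (S₂ := IsSFT) isSFT_full
    (isSFT_angleRel g) (equivalence_angleRel g) ψ hψ hker)
  obtain ⟨len, p, -, hp, hlen⟩ := exists_geodesic_ray hg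
  have hinj : Function.Injective p := fun a b hab => by rw [← hlen a, ← hlen b, hab]
  choose a ha using hp
  let q : FullShift M (ι × Bool) → (full M (ι × Bool)).Quot (angleRel g) (equivalence_angleRel g) :=
    fun x => Subshift.Quot.mk _ _ _ ⟨x, mem_full x⟩
  have hq : Continuous q := continuous_quot_mk.comp (continuous_id.subtype_mk _)
  have hqker : ∀ x y, q x = q y ↔ FullShift.pair x y ∈ (angleRel g).carrier := fun x y =>
    Quotient.eq (r := Setoid.mk _ (equivalence_angleRel g))
  -- The expansions `000...` and `1000...` have angles `0` and `1 / 2` at `p 0`.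
  have hne : q (rayConfig p a j₀ fun _ => false) ≠ q (rayConfig p a j₀ fun i => i = 0) := by
    intro h
    have h1 := ((pair_mem_angleRel g).1 ((hqker _ _).1 h) (p 0)).2
    have h2 := binary_rayConfig_succ (j₀ := j₀) hinj ha (fun i => i = 0) 0
    rw [binary_rayConfig_of_false hinj ha (i := 0 + 1) fun k hk => decide_eq_false (by omega)] at h2
    simp only [decide_true, if_true, add_zero] at h2
    have h3 : binary g (p 0 • rayConfig p a j₀ fun i => i = 0) = 1 / 2 := by linarith
    rw [angle, angle, h3, binary_rayConfig_of_false hinj ha fun _ _ => rfl, AddCircle.coe_zero,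
      eq_comm, ← norm_eq_zero, (AddCircle.norm_coe_eq_abs_iff _ one_ne_zero).2] at h1
    · norm_num at h1
    · norm_num
  -- A conjugate subshift would have a clopen set separating these two classes; its preimage is
  -- invariant under the relation and contradicts `rayConfig_mem_iff`.
  obtain ⟨U, hU, h0, h1⟩ := exists_isClopen_of_totally_separated (e.symm.injective.ne hne)
  have hV : IsClopen ((fun x => e.symm (q x)) ⁻¹' U) := hU.preimage (e.symm.continuous.comp hq)
  refine h1 ((rayConfig_mem_iff hinj ha hj hV (fun x y hxy => ?_) _ _).1 h0)
  rw [mem_preimage, mem_preimage, (hqker x y).2 hxy]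

end BinaryExpansions

end SymbolicQuotients

theorem theorem2 {M : Type u} [Monoid M] [Infinite M] (hM : Monoid.FG M) :
    SymbolicQuotients.systemsOf (M := M) SymbolicQuotients.Subshift.IsSFT ⊂
        SymbolicQuotients.systemsOf (M := M) SymbolicQuotients.Subshift.IsSofic ∧
      SymbolicQuotients.systemsOf (M := M) SymbolicQuotients.Subshift.IsSofic ⊂
        SymbolicQuotients.systemsPer (M := M) SymbolicQuotients.Subshift.IsSFT
          SymbolicQuotients.Subshift.IsSFT ∧
      SymbolicQuotients.systemsPer (M := M) SymbolicQuotients.Subshift.IsSFT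
          SymbolicQuotients.Subshift.IsSFT =
        SymbolicQuotients.systemsPer (M := M) SymbolicQuotients.Subshift.IsSofic
          SymbolicQuotients.Subshift.IsSFT ∧
      SymbolicQuotients.systemsPer (M := M) SymbolicQuotients.Subshift.IsSofic
          SymbolicQuotients.Subshift.IsSFT ⊂
        SymbolicQuotients.systemsPer (M := M) SymbolicQuotients.Subshift.IsSFT
          SymbolicQuotients.Subshift.IsSofic ∧
      SymbolicQuotients.systemsPer (M := M) SymbolicQuotients.Subshift.IsSFT
          SymbolicQuotients.Subshift.IsSofic =
        SymbolicQuotients.systemsPer (M := M) SymbolicQuotients.Subshift.IsSofic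
          SymbolicQuotients.Subshift.IsSofic := by
  obtain ⟨ι, _, g, hg, j, hj⟩ := SymbolicQuotients.exists_generators hM
  exact ⟨SymbolicQuotients.systemsOf_isSFT_ssubset hg,
    SymbolicQuotients.systemsOf_isSofic_ssubset hg hj,
    SymbolicQuotients.systemsPer_isSFT_isSFT_eq,
    SymbolicQuotients.systemsPer_isSofic_isSFT_ssubset hg,
    SymbolicQuotients.systemsPer_isSFT_isSofic_eq⟩
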